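/- Let $X_1,X_2,X_3$ be independent random variables, each with the gamma density $g(x)=xe^{-x}$ for $x>0$ (and $0$ for $x\le 0$). Let $\bar X=\frac13\sum_{i=1}^3X_i$ be the sample mean, let $S=\sqrt{\frac13\sum_{i=1}^3(X_i-\bar X)^2}$ be the square root of the biased sample variance, and let $T=\bar X/S$. Then the cumulative distribution function $G(t)=P(T\le t)$ of $T$ is $$ G(t)=\begin{cases} 1-\dfrac{10\pi\,(4t^2-3)}{27\sqrt3\,t^4}, & t\ge\sqrt2,\\[2ex] 1+\dfrac{\sqrt{2-t^2}\,\left(-33t^4-13t^2+8\right)+5\pi t\,(4t^2-3)-30t\,(4t^2-3)\arcsin\left(\frac{t}{\sqrt2}\right)}{27\sqrt3\,t^5}, & \frac{\sqrt2}{2}\le t\le\sqrt2,\\[2ex] 0, & t\le\frac{\sqrt2}{2}. \end{cases} $$ -/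

import Mathlib

open MeasureTheory ProbabilityTheory

/-- The sample mean `(x₁ + ⋯ + xₙ) / n`. -/
noncomputable def sampleMean {n : ℕ} (x : Fin n → ℝ) : ℝ :=
  (∑ i, x i) / n

/-- The biased sample variance `(1/n) ∑ᵢ (xᵢ - x̄)²`. -/
noncomputable def sampleVariance {n : ℕ} (x : Fin n → ℝ) : ℝ :=
  (∑ i, (x i - sampleMean x) ^ 2) / n

/-- The statistic `T = x̄ / S`, where `S` is the square root of the biased sample variance. -/
noncomputable def statT {n : ℕ} (x : Fin n → ℝ) : ℝ :=
  sampleMean x / √(sampleVariance x)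

/-- The law on the real line with density `g(x) = x e^{-x}` for `x > 0` (and `0` elsewhere). -/
noncomputable def gammaTwoLaw : Measure ℝ :=
  volume.withDensity fun x => ENNReal.ofReal (if 0 < x then x * Real.exp (-x) else 0)

/-- This law is the gamma distribution with shape `2` and rate `1`. -/
theorem gammaTwoLaw_eq_gammaMeasure : gammaTwoLaw = gammaMeasure 2 1 := by
  unfold gammaTwoLaw gammaMeasure
  congr 1
  funext x
  simp only [gammaPDF, gammaPDFReal]
  congr 1
  rcases lt_trichotomy x 0 with h | h | h
  · simp [h.not_ge, h.le.not_gt]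
  · subst h
    norm_num
  · rw [if_pos h, if_pos h.le]
    have h2 : ((2 : ℝ) - 1) = 1 := by norm_num
    simp [h2]

/-! For `t > 0`, the event `T > t` is, up to a null set, membership of the sample in a circular cone
about the diagonal (`meanCone`). Put `s = x₀ + x₁ + x₂`. The joint density `x₀x₁x₂e^{-s}` is
`e^{-s}` times a cubic form, so the scale `s` integrates out and only the shape `x / s` in the plane
of coordinate sum 1 remains. There the cone cuts out the disc `y² + z²/3 < ρ²` with `ρ = √2 / (3t)`,
and the positive octant cuts out an equilateral triangle with inradius `1/3` and circumradius `2/3`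
in this metric.

The signed cubic is integrated over the whole disc, and the three caps where some `xᵢ ≤ 0` are
subtracted. For `t ≥ √2/2`, i.e. `ρ ≤ 2/3`, the caps do not overlap, so no further correction is
needed (`pos_of_mem_meanCone`, `measureReal_lt_statT`). By symmetry the caps contribute equally, and
one primitive, `shapePrimitive`, evaluates disc and cap. For `t ≥ √2` the caps carry no mass; at `t
= √2/2` the disc covers the triangle and the cdf vanishes. -/

/-! ### Separating scale from shape -/

/-- The linear change of variables `(s, p, q) ↦ (p, (s - p + q) / 2, (s - p - q) / 2)`, for which
`s` is the sum of the coordinates, `p` the first one and `q` the difference of the others. -/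
noncomputable def sumCoords : (Fin 3 → ℝ) →ₗ[ℝ] (Fin 3 → ℝ) :=
  Matrix.toLin' !![0, 1, 0; 1 / 2, -1 / 2, 1 / 2; 1 / 2, -1 / 2, -1 / 2]

lemma sumCoords_apply (v : Fin 3 → ℝ) :
    sumCoords v = ![v 1, (v 0 - v 1 + v 2) / 2, (v 0 - v 1 - v 2) / 2] := by
  ext i
  fin_cases i <;>
    simp [sumCoords, Matrix.mulVec, dotProduct, Fin.sum_univ_three] <;> ring

lemma det_sumCoords : LinearMap.det sumCoords = 1 / 2 := by
  rw [sumCoords, LinearMap.det_toLin', Matrix.det_fin_three]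
  simp
  norm_num

lemma map_sumCoords :
    Measure.map sumCoords volume = ENNReal.ofReal 2 • (volume : Measure (Fin 3 → ℝ)) := by
  rw [Measure.map_linearMap_addHaar_eq_smul_addHaar _ (by rw [det_sumCoords]; norm_num),
    det_sumCoords]
  norm_num

lemma measurableEmbedding_sumCoords : MeasurableEmbedding sumCoords := by
  have h : sumCoords.det ≠ 0 := by rw [det_sumCoords]; norm_num
  exact (sumCoords.equivOfDetNeZero h).toContinuousLinearEquiv.toHomeomorph.measurableEmbedding

/-- Integration over `ℝ³` as an iterated integral over the coordinate sum, the first coordinate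
and the difference of the other two. -/
lemma integral_fin_three_eq_iterated {g : (Fin 3 → ℝ) → ℝ} (hg : Integrable g) :
    ∫ x, g x =
      (1 / 2) * ∫ s, ∫ p, ∫ q, g ![p, (s - p + q) / 2, (s - p - q) / 2] := by
  have hemb := measurableEmbedding_sumCoords
  have h2 : ∫ v, g (sumCoords v) = 2 * ∫ x, g x := by
    rw [← hemb.integral_map, map_sumCoords, integral_smul_measure]
    norm_num
  have hint : Integrable (fun v => g (sumCoords v)) := by
    have : Integrable g (Measure.map sumCoords volume) := by
      rw [map_sumCoords]
      exact hg.smul_measure (by simp)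
    exact (hemb.integrable_map_iff).1 this
  let e : (Fin 3 → ℝ) ≃ᵐ ℝ × ℝ × ℝ :=
    (MeasurableEquiv.piFinSuccAbove (fun _ : Fin 3 => ℝ) 0).trans
      ((MeasurableEquiv.refl ℝ).prodCongr MeasurableEquiv.finTwoArrow)
  have he : MeasurePreserving e volume volume :=
    ((MeasurePreserving.id volume).prod (volume_preserving_finTwoArrow ℝ)).comp
      (volume_preserving_piFinSuccAbove (fun _ : Fin 3 => ℝ) 0)
  let G : ℝ × ℝ × ℝ → ℝ := fun v => g ![v.2.1, (v.1 - v.2.1 + v.2.2) / 2, (v.1 - v.2.1 - v.2.2) / 2]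
  have hG : (fun v => g (sumCoords v)) = G ∘ e := by
    funext v
    rw [sumCoords_apply]
    rfl
  have hGint : Integrable G :=
    (he.integrable_comp_emb e.measurableEmbedding).1 (hG ▸ hint)
  have h3 : ∫ v, g (sumCoords v) = ∫ v, G v := by
    rw [← he.integral_comp e.measurableEmbedding]
    exact congrArg (fun F => ∫ v, F v) hG
  have h4 : ∫ v, G v = ∫ s, ∫ p, ∫ q, G (s, p, q) := by
    rw [Measure.volume_eq_prod, integral_prod _ hGint]
    refine integral_congr_ae ?_
    filter_upwards [Integrable.prod_right_ae hGint] with s hs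
    rw [Measure.volume_eq_prod, integral_prod _ hs]
  rw [← h4, ← h3, h2]
  ring

lemma integral_pow_five_mul_exp_neg :
    ∫ s in Set.Ioi (0 : ℝ), s ^ 5 * Real.exp (-s) = 120 := by
  have h := Real.integral_rpow_mul_exp_neg_mul_Ioi (a := 6) (r := 1) (by norm_num) one_pos
  have h6 : Real.Gamma 6 = 120 := by
    rw [show (6 : ℝ) = ((5 : ℕ) : ℝ) + 1 by norm_num, Real.Gamma_nat_eq_factorial]
    norm_num [Nat.factorial]
  rw [h6] at h
  norm_num at h
  rw [← h]

/-- The integral of a function which, in terms of the coordinate sum `s`, is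
`s³ e^{-s}` times a function of the ratios `x₀ / s - 1 / 3` and `(x₁ - x₂) / s`. -/
lemma integral_sum_pow_three_mul_exp (D : ℝ → ℝ → ℝ) {g : (Fin 3 → ℝ) → ℝ} (hg : Integrable g)
    (hneg : ∀ x, x 0 + x 1 + x 2 ≤ 0 → g x = 0)
    (hpos : ∀ s y z, 0 < s →
      g ![s * (y + 1 / 3), (s - s * (y + 1 / 3) + s * z) / 2,
        (s - s * (y + 1 / 3) - s * z) / 2] = s ^ 3 * Real.exp (-s) * D y z) :
    ∫ x, g x = 60 * ∫ y, ∫ z, D y z := by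
  rw [integral_fin_three_eq_iterated hg]
  have hs : (fun s : ℝ => ∫ p, ∫ q, g ![p, (s - p + q) / 2, (s - p - q) / 2]) =
      (Set.Ioi 0).indicator fun s => s ^ 5 * Real.exp (-s) * ∫ y, ∫ z, D y z := by
    funext s
    by_cases h : 0 < s
    · rw [Set.indicator_of_mem (Set.mem_Ioi.2 h)]
      -- The substitutions `q = s z` and `p = s (y + 1/3)` each give a factor `s`, turning `s³` into
      -- `s⁵`; the constant is then `Γ(6) / 2 = 60`.
      have hq : ∀ p, ∫ q, g ![p, (s - p + q) / 2, (s - p - q) / 2] =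
          s * ∫ z, g ![p, (s - p + s * z) / 2, (s - p - s * z) / 2] := by
        intro p
        rw [Measure.integral_comp_mul_left
          (fun q => g ![p, (s - p + q) / 2, (s - p - q) / 2]) s, abs_of_pos (inv_pos.2 h),
          smul_eq_mul, mul_inv_cancel_left₀ h.ne']
      simp_rw [hq]
      rw [integral_const_mul]
      have hp : ∀ H : ℝ → ℝ, ∫ p, H p = s * ∫ y, H (s * (y + 1 / 3)) := by
        intro H
        rw [integral_add_right_eq_self (fun y => H (s * y)), Measure.integral_comp_mul_left H s,
          abs_of_pos (inv_pos.2 h), smul_eq_mul, mul_inv_cancel_left₀ h.ne']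
      rw [hp]
      simp_rw [hpos s _ _ h, integral_const_mul]
      ring
    · rw [Set.indicator_of_notMem (by simpa using h)]
      have : ∀ p q : ℝ, g ![p, (s - p + q) / 2, (s - p - q) / 2] = 0 := by
        intro p q
        apply hneg
        simp
        linarith
      simp [this]
  rw [hs, integral_indicator measurableSet_Ioi, integral_mul_const,
    integral_pow_five_mul_exp_neg]
  ring

/-! ### Integrals over discs and caps -/

/-- The density of the shape in the section of the simplex by a disc, in the coordinates
`y = x₀ / s - 1 / 3` and `z = (x₁ - x₂) / s`, cut off at `y ≤ c`. -/
noncomputable def shapeDensity (ρ c y z : ℝ) : ℝ :=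
  if y ≤ c ∧ z ^ 2 < 3 * (ρ ^ 2 - y ^ 2) then (1 / 3 + y) * ((2 / 3 - y) ^ 2 - z ^ 2) / 4 else 0

lemma integral_if_sq_lt (a b W : ℝ) :
    ∫ z, (if z ^ 2 < W then a * (b - z ^ 2) else 0) = a * (2 * b * √W - 2 / 3 * √W ^ 3) := by
  have h : (fun z : ℝ => if z ^ 2 < W then a * (b - z ^ 2) else 0) =
      (Set.Ioo (-√W) √W).indicator fun z => a * (b - z ^ 2) := by
    funext z
    rw [Set.indicator_apply]
    simp only [Set.mem_Ioo, Real.sq_lt]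
  rw [h, integral_indicator measurableSet_Ioo, ← integral_Ioc_eq_integral_Ioo,
    ← intervalIntegral.integral_of_le (by linarith [Real.sqrt_nonneg W])]
  rw [intervalIntegral.integral_const_mul, intervalIntegral.integral_sub (by simp)
    (by apply Continuous.intervalIntegrable; fun_prop)]
  rw [intervalIntegral.integral_const, integral_pow, smul_eq_mul]
  push_cast
  ring

lemma integral_shapeDensity_right (ρ c y : ℝ) :
    ∫ z, shapeDensity ρ c y z = if y ≤ c then
      √3 / 2 * (√(ρ ^ 2 - y ^ 2) *
        (4 / 27 - ρ ^ 2 / 3 - ρ ^ 2 * y - 2 / 3 * y ^ 2 + 2 * y ^ 3)) else 0 := by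
  by_cases hc : y ≤ c
  · simp only [shapeDensity, hc, true_and, if_true]
    have h := integral_if_sq_lt ((1 / 3 + y) / 4) ((2 / 3 - y) ^ 2) (3 * (ρ ^ 2 - y ^ 2))
    rw [Real.sqrt_mul (by norm_num), mul_pow, pow_succ √3, Real.sq_sqrt (by norm_num),
      pow_succ √(ρ ^ 2 - y ^ 2)] at h
    -- Outside the disc the root is `0` by convention, so the identity survives a negative radicand.
    have h0 : √(ρ ^ 2 - y ^ 2) ^ 2 * √(ρ ^ 2 - y ^ 2) =
        (ρ ^ 2 - y ^ 2) * √(ρ ^ 2 - y ^ 2) := by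
      rcases le_total 0 (ρ ^ 2 - y ^ 2) with h1 | h1
      · rw [Real.sq_sqrt h1]
      · simp [Real.sqrt_eq_zero_of_nonpos h1]
    rw [h0] at h
    convert h using 1
    · congr 1
      funext z
      congr 1
      ring
    · ring
  · simp [shapeDensity, hc]

/-- An antiderivative of `√(ρ² - y²) (4/27 - ρ²/3 - ρ² y - 2 y²/3 + 2 y³)`. -/
noncomputable def shapePrimitive (ρ y : ℝ) : ℝ :=
  ρ ^ 2 * (2 / 27 - ρ ^ 2 / 4) * Real.arcsin (y / ρ) +
    √(ρ ^ 2 - y ^ 2) * ((4 / 27 - ρ ^ 2 / 3) * y / 2 - ρ ^ 2 / 12 * y +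
      (ρ ^ 2 - y ^ 2) * (y / 6 - ρ ^ 2 / 3) + 2 / 5 * (ρ ^ 2 - y ^ 2) ^ 2)

lemma hasDerivAt_shapePrimitive {ρ y : ℝ} (h1 : -ρ < y) (h2 : y < ρ) :
    HasDerivAt (shapePrimitive ρ) (√(ρ ^ 2 - y ^ 2) *
      (4 / 27 - ρ ^ 2 / 3 - ρ ^ 2 * y - 2 / 3 * y ^ 2 + 2 * y ^ 3)) y := by
  have hρ : 0 < ρ := by linarith
  have hW : 0 < ρ ^ 2 - y ^ 2 := by nlinarith
  have hw : 0 < √(ρ ^ 2 - y ^ 2) := Real.sqrt_pos.2 hW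
  have hW' : HasDerivAt (fun y => ρ ^ 2 - y ^ 2) (-(2 * y)) y := by
    simpa using (hasDerivAt_pow 2 y).const_sub (ρ ^ 2)
  have hs := hW'.sqrt hW.ne'
  have ha := (Real.hasDerivAt_arcsin (x := y / ρ)
    (by rw [ne_eq, div_eq_iff hρ.ne']; linarith) (by rw [ne_eq, div_eq_iff hρ.ne']; linarith)).comp y
    ((hasDerivAt_id y).div_const ρ)
  have hq : √(1 - (y / ρ) ^ 2) = √(ρ ^ 2 - y ^ 2) / ρ := by
    rw [← Real.sqrt_sq hρ.le, ← Real.sqrt_div' _ (sq_nonneg ρ), Real.sqrt_sq hρ.le]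
    congr 1
    field_simp
  rw [hq] at ha
  have hp := ((((hasDerivAt_id y).const_mul (4 / 27 - ρ ^ 2 / 3)).div_const 2).sub
    ((hasDerivAt_id y).const_mul (ρ ^ 2 / 12))).add
    (hW'.mul (((hasDerivAt_id y).div_const 6).sub_const (ρ ^ 2 / 3)))
  have hp' := hp.add ((hW'.pow 2).const_mul (2 / 5))
  have h := (ha.const_mul (ρ ^ 2 * (2 / 27 - ρ ^ 2 / 4))).add (hs.mul hp')
  refine h.congr_deriv ?_
  set w := √(ρ ^ 2 - y ^ 2) with hwdef
  have hw2 : w ^ 2 = ρ ^ 2 - y ^ 2 := Real.sq_sqrt hW.le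
  simp
  field_simp
  rw [show w ^ 2 = ρ ^ 2 - y ^ 2 from hw2]
  ring

lemma continuous_shapePrimitive (ρ : ℝ) : Continuous (shapePrimitive ρ) := by
  unfold shapePrimitive
  fun_prop

/-- Left of `-ρ` the root is `0` and `arcsin` is clamped, so the primitive is constant. The cap
formula thus also covers an empty cap, as needed for `t ≥ √2`. -/
lemma shapePrimitive_of_le_neg {ρ c : ℝ} (hρ : 0 < ρ) (hc : c ≤ -ρ) :
    shapePrimitive ρ c = shapePrimitive ρ (-ρ) := by
  have h1 : ρ ^ 2 - c ^ 2 ≤ 0 := by nlinarith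
  have h2 : c / ρ ≤ -1 := by rwa [div_le_iff₀ hρ, neg_one_mul]
  simp [shapePrimitive, Real.sqrt_eq_zero_of_nonpos h1, Real.arcsin_of_le_neg_one h2, neg_div,
    hρ.ne']

lemma integral_shapeDensity {ρ c : ℝ} (hρ : 0 < ρ) (h2 : c ≤ ρ) :
    ∫ y, ∫ z, shapeDensity ρ c y z =
      √3 / 2 * (shapePrimitive ρ c - shapePrimitive ρ (-ρ)) := by
  simp_rw [integral_shapeDensity_right]
  have h : (fun y : ℝ => if y ≤ c then √3 / 2 * (√(ρ ^ 2 - y ^ 2) *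
        (4 / 27 - ρ ^ 2 / 3 - ρ ^ 2 * y - 2 / 3 * y ^ 2 + 2 * y ^ 3)) else 0) =
      (Set.Ioc (-ρ) c).indicator fun y => √3 / 2 * (√(ρ ^ 2 - y ^ 2) *
        (4 / 27 - ρ ^ 2 / 3 - ρ ^ 2 * y - 2 / 3 * y ^ 2 + 2 * y ^ 3)) := by
    funext y
    rw [Set.indicator_apply]
    by_cases hc : y ≤ c
    · by_cases hy : -ρ < y
      · simp [hc, hy]
      · have : ρ ^ 2 - y ^ 2 ≤ 0 := by nlinarith
        simp [Real.sqrt_eq_zero_of_nonpos this]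
    · simp [hc]
  rw [h, integral_indicator measurableSet_Ioc]
  rcases le_total c (-ρ) with h1 | h1
  · simp [Set.Ioc_eq_empty_of_le h1, shapePrimitive_of_le_neg hρ h1]
  rw [← intervalIntegral.integral_of_le h1,
    intervalIntegral.integral_const_mul]
  rw [intervalIntegral.integral_eq_sub_of_hasDerivAt_of_le h1
    (continuous_shapePrimitive ρ).continuousOn
    (fun y hy => hasDerivAt_shapePrimitive hy.1 (hy.2.trans_le h2))
    (by apply Continuous.intervalIntegrable; fun_prop)]

lemma shapePrimitive_self {ρ : ℝ} (hρ : 0 < ρ) :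
    shapePrimitive ρ ρ = ρ ^ 2 * (2 / 27 - ρ ^ 2 / 4) * (Real.pi / 2) := by
  simp [shapePrimitive, hρ.ne']

lemma shapePrimitive_neg_self {ρ : ℝ} (hρ : 0 < ρ) :
    shapePrimitive ρ (-ρ) = -(ρ ^ 2 * (2 / 27 - ρ ^ 2 / 4) * (Real.pi / 2)) := by
  simp [shapePrimitive, hρ.ne', neg_div]

/-! ### Product densities and integrability -/

/-- A product of measures on `ℝ` with integrable densities has the product density. -/
lemma pi_withDensity_ofReal {ι : Type*} [Fintype ι] {f : ι → ℝ → ℝ}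
    (hf : ∀ i, Integrable (f i)) (h0 : ∀ i x, 0 ≤ f i x) :
    Measure.pi (fun i => volume.withDensity fun x => ENNReal.ofReal (f i x)) =
      volume.withDensity fun x : ι → ℝ => ENNReal.ofReal (∏ i, f i (x i)) := by
  have hfin : ∀ i, IsFiniteMeasure (volume.withDensity fun x => ENNReal.ofReal (f i x)) :=
    fun i => isFiniteMeasure_withDensity_ofReal (hf i).2
  refine Measure.pi_eq (μ := fun i => volume.withDensity fun x => ENNReal.ofReal (f i x))
    fun s hs => ?_
  rw [withDensity_apply _ (MeasurableSet.univ_pi hs), volume_pi, Measure.restrict_pi_pi,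
    ← ofReal_integral_eq_lintegral_ofReal
      (Integrable.fintype_prod fun i => (hf i).integrableOn (s := s i))
      (ae_of_all _ fun x => Finset.prod_nonneg fun i _ => h0 i _),
    integral_fintype_prod_eq_prod,
    ENNReal.ofReal_prod_of_nonneg fun i _ => integral_nonneg (h0 i)]
  refine Finset.prod_congr rfl fun i _ => ?_
  rw [withDensity_apply _ (hs i),
    ofReal_integral_eq_lintegral_ofReal (hf i).integrableOn (ae_of_all _ (h0 i))]

lemma integrable_abs_mul_exp_neg_abs {b : ℝ} (hb : 0 < b) :
    Integrable fun x : ℝ => |x| * Real.exp (-(b * |x|)) := by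
  have h : IntegrableOn (fun x : ℝ => x * Real.exp (-(b * x))) (Set.Ioi 0) := by
    have := integrableOn_rpow_mul_exp_neg_mul_rpow (s := 1) (p := 1) (b := b) (by norm_num)
      one_pos hb
    simpa using this
  have hG := (integrable_indicator_iff measurableSet_Ioi).2 h
  refine (hG.add hG.comp_neg).congr (ae_of_all _ fun x => ?_)
  rcases lt_trichotomy x 0 with hx | hx | hx
  · simp [hx, hx.le, abs_of_neg hx]
  · simp [hx]
  · simp [hx, hx.le, abs_of_pos hx]

lemma integrable_gammaTwo_density :
    Integrable fun x : ℝ => if 0 < x then x * Real.exp (-x) else 0 := by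
  have h : (fun x : ℝ => if 0 < x then x * Real.exp (-x) else 0) =
      (Set.Ioi 0).indicator fun x => |x| * Real.exp (-(1 * |x|)) := by
    funext x
    by_cases hx : 0 < x
    · simp [hx, abs_of_pos hx]
    · simp [hx]
  rw [h]
  exact (integrable_abs_mul_exp_neg_abs one_pos).indicator measurableSet_Ioi

/-! ### The cone and its caps -/

/-- The points of `ℝ³` with positive coordinate sum at which the mean exceeds `t` times the
standard deviation. -/
def meanCone (t : ℝ) : Set (Fin 3 → ℝ) :=
  {x | 0 < x 0 + x 1 + x 2 ∧
    t ^ 2 * (3 * (x 0 ^ 2 + x 1 ^ 2 + x 2 ^ 2) - (x 0 + x 1 + x 2) ^ 2) <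
      (x 0 + x 1 + x 2) ^ 2}

lemma measurableSet_meanCone (t : ℝ) : MeasurableSet (meanCone t) :=
  (measurableSet_lt (f := fun _ : Fin 3 → ℝ => (0 : ℝ)) (g := fun x => x 0 + x 1 + x 2)
    (by fun_prop) (by fun_prop)).inter
    (measurableSet_lt (f := fun x : Fin 3 → ℝ =>
      t ^ 2 * (3 * (x 0 ^ 2 + x 1 ^ 2 + x 2 ^ 2) - (x 0 + x 1 + x 2) ^ 2))
      (g := fun x => (x 0 + x 1 + x 2) ^ 2) (by fun_prop) (by fun_prop))

/-- Both sides of `t S < x̄` are nonnegative, so it may be squared. Distinct coordinates keep `S`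
positive, avoiding division by zero. -/
lemma lt_statT_iff {t : ℝ} (ht : 0 < t) {x : Fin 3 → ℝ} (hs : 0 < x 0 + x 1 + x 2)
    (hne : x 0 ≠ x 1) : t < statT x ↔ x ∈ meanCone t := by
  have hm : sampleMean x = (x 0 + x 1 + x 2) / 3 := by
    simp [sampleMean, Fin.sum_univ_three]
  have hv : sampleVariance x =
      (3 * (x 0 ^ 2 + x 1 ^ 2 + x 2 ^ 2) - (x 0 + x 1 + x 2) ^ 2) / 9 := by
    simp only [sampleVariance, hm, Fin.sum_univ_three]
    push_cast
    ring
  have hpos : 0 < sampleVariance x := by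
    rw [hv]
    have := sq_pos_of_ne_zero (sub_ne_zero.2 hne)
    nlinarith [sq_nonneg (x 0 - x 2), sq_nonneg (x 1 - x 2)]
  rw [statT, lt_div_iff₀ (Real.sqrt_pos.2 hpos),
    ← sq_lt_sq₀ (by positivity) (by rw [hm]; positivity), mul_pow, Real.sq_sqrt hpos.le, hm, hv]
  simp only [meanCone, Set.mem_ofPred_eq, hs, true_and]
  constructor <;> intro h <;> linarith

lemma abs_le_sum_of_mem_meanCone {t : ℝ} (ht : 1 / 2 ≤ t ^ 2) {x : Fin 3 → ℝ}
    (hx : x ∈ meanCone t) (i : Fin 3) : |x i| ≤ x 0 + x 1 + x 2 := by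
  obtain ⟨hs, h⟩ := hx
  have h1 : x 0 ^ 2 + x 1 ^ 2 + x 2 ^ 2 ≤ (x 0 + x 1 + x 2) ^ 2 := by
    nlinarith [sq_nonneg (x 0 - x 1), sq_nonneg (x 0 - x 2), sq_nonneg (x 1 - x 2)]
  refine abs_le_of_sq_le_sq (le_trans ?_ h1) hs.le
  fin_cases i <;> simp <;> nlinarith [sq_nonneg (x 0), sq_nonneg (x 1), sq_nonneg (x 2)]

/-- The function `x₀ x₁ x₂ e^{-(x₀ + x₁ + x₂)}`, the joint density on the positive octant. -/
noncomputable def jointDensity (x : Fin 3 → ℝ) : ℝ :=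
  x 0 * x 1 * x 2 * Real.exp (-(x 0 + x 1 + x 2))

lemma integrable_indicator_meanCone {t : ℝ} (ht : 1 / 2 ≤ t ^ 2) :
    Integrable ((meanCone t).indicator jointDensity) := by
  -- On the cone each `|xᵢ| ≤ s`, so their average is at most `s` and `e^{-s} ≤ ∏ e^{-|xᵢ|/3}`: an
  -- integrable product dominates.
  have hb : Integrable fun x : Fin 3 → ℝ => ∏ i, |x i| * Real.exp (-(1 / 3 * |x i|)) :=
    Integrable.fintype_prod (f := fun (_ : Fin 3) (x : ℝ) => |x| * Real.exp (-(1 / 3 * |x|)))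
      fun _ => integrable_abs_mul_exp_neg_abs (by norm_num)
  have hc : Continuous jointDensity := by
    unfold jointDensity
    fun_prop
  refine hb.mono' (hc.measurable.indicator (measurableSet_meanCone t)).aestronglyMeasurable
    (ae_of_all _ fun x => ?_)
  by_cases hx : x ∈ meanCone t
  · rw [Set.indicator_of_mem hx, Finset.prod_mul_distrib, ← Real.exp_sum, Fin.prod_univ_three,
      Fin.sum_univ_three, jointDensity, Real.norm_eq_abs, abs_mul, abs_mul, abs_mul, Real.abs_exp]
    have h := abs_le_sum_of_mem_meanCone ht hx
    gcongr
    linarith [h 0, h 1, h 2]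
  · rw [Set.indicator_of_notMem hx, norm_zero]
    positivity

/-- On the cone at most one coordinate is nonpositive. -/
lemma pos_of_mem_meanCone {t : ℝ} (ht : 1 / 2 ≤ t ^ 2) {x : Fin 3 → ℝ}
    (hx : x ∈ meanCone t) {i j : Fin 3} (hij : i ≠ j) (hi : x i ≤ 0) : 0 < x j := by
  obtain ⟨hs, h⟩ := hx
  by_contra! hj
  have h1 : x 0 ^ 2 + x 1 ^ 2 + x 2 ^ 2 < (x 0 + x 1 + x 2) ^ 2 := by
    nlinarith [sq_nonneg (x 0 - x 1), sq_nonneg (x 0 - x 2), sq_nonneg (x 1 - x 2)]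
  -- The last hypothesis says `ab + c(a + b) > 0`, but `c > -(a + b) ≥ 0` bounds this by `ab - (a +
  -- b)² ≤ 0`.
  have key : ∀ a b c : ℝ, 0 < a + b + c → a ≤ 0 → b ≤ 0 →
      a ^ 2 + b ^ 2 + c ^ 2 < (a + b + c) ^ 2 → False := by
    intro a b c h0 ha hb hlt
    nlinarith [mul_nonneg_of_nonpos_of_nonpos ha hb, mul_nonneg_of_nonpos_of_nonpos ha ha]
  fin_cases i <;> fin_cases j <;> simp at hij hi hj
  · exact key _ _ _ hs hi hj h1
  · exact key (x 0) (x 2) (x 1) (by linarith) hi hj (by linarith)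
  · exact key _ _ _ hs hj hi h1
  · exact key (x 1) (x 2) (x 0) (by linarith) hi hj (by linarith)
  · exact key (x 0) (x 2) (x 1) (by linarith) hj hi (by linarith)
  · exact key (x 1) (x 2) (x 0) (by linarith) hj hi (by linarith)

lemma integrable_indicator_meanCone_inter {t : ℝ} (ht : 1 / 2 ≤ t ^ 2) {B : Set (Fin 3 → ℝ)}
    (hB : MeasurableSet B) : Integrable ((meanCone t ∩ B).indicator jointDensity) := by
  rw [Set.inter_comm, ← Set.indicator_indicator]
  exact (integrable_indicator_meanCone ht).indicator hB

lemma measurableSet_apply_nonpos (i : Fin 3) : MeasurableSet {x : Fin 3 → ℝ | x i ≤ 0} :=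
  measurableSet_le (measurable_pi_apply i) measurable_const

lemma mem_meanCone_iff {t s y z : ℝ} (ht : 0 < t) (hs : 0 < s) :
    ![s * (y + 1 / 3), (s - s * (y + 1 / 3) + s * z) / 2,
      (s - s * (y + 1 / 3) - s * z) / 2] ∈ meanCone t ↔
      z ^ 2 < 3 * ((√2 / (3 * t)) ^ 2 - y ^ 2) := by
  have hρ : (√2 / (3 * t)) ^ 2 = 2 / (9 * t ^ 2) := by
    rw [div_pow, Real.sq_sqrt (by norm_num)]
    ring
  have hsum : s * (y + 1 / 3) + (s - s * (y + 1 / 3) + s * z) / 2 +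
      (s - s * (y + 1 / 3) - s * z) / 2 = s := by ring
  have hsq : 3 * ((s * (y + 1 / 3)) ^ 2 + ((s - s * (y + 1 / 3) + s * z) / 2) ^ 2 +
      ((s - s * (y + 1 / 3) - s * z) / 2) ^ 2) - s ^ 2 =
      s ^ 2 * (9 / 2 * y ^ 2 + 3 / 2 * z ^ 2) := by ring
  simp only [meanCone, Set.mem_ofPred_eq, Matrix.cons_val]
  rw [hsum, hsq, hρ, and_iff_right hs]
  have h1 : t ^ 2 * (s ^ 2 * (9 / 2 * y ^ 2 + 3 / 2 * z ^ 2)) < s ^ 2 ↔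
      t ^ 2 * (9 / 2 * y ^ 2 + 3 / 2 * z ^ 2) < 1 := by
    rw [mul_left_comm]
    exact mul_lt_iff_lt_one_right (by positivity)
  have h2 : t ^ 2 * (2 / (9 * t ^ 2)) = 2 / 9 := by field_simp
  rw [h1]
  constructor
  · intro h
    refine lt_of_mul_lt_mul_left ?_ (sq_nonneg t)
    nlinarith
  · intro h
    nlinarith [mul_lt_mul_of_pos_left h (show 0 < t ^ 2 by positivity)]

lemma jointDensity_eq (s y z : ℝ) :
    jointDensity ![s * (y + 1 / 3), (s - s * (y + 1 / 3) + s * z) / 2,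
      (s - s * (y + 1 / 3) - s * z) / 2] =
      s ^ 3 * Real.exp (-s) * ((1 / 3 + y) * ((2 / 3 - y) ^ 2 - z ^ 2) / 4) := by
  simp only [jointDensity, Matrix.cons_val]
  ring_nf

lemma integral_meanCone {t : ℝ} (ht : 0 < t) (ht2 : 1 / 2 ≤ t ^ 2) :
    ∫ x, (meanCone t).indicator jointDensity x =
      30 * √3 * (shapePrimitive (√2 / (3 * t)) (√2 / (3 * t)) -
        shapePrimitive (√2 / (3 * t)) (-(√2 / (3 * t)))) := by
  set ρ := √2 / (3 * t) with hρ
  have hρ0 : 0 < ρ := by positivity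
  rw [integral_sum_pow_three_mul_exp (shapeDensity ρ ρ) (integrable_indicator_meanCone ht2),
    integral_shapeDensity hρ0 le_rfl]
  · ring
  · intro x hx
    exact Set.indicator_of_notMem (fun h => hx.not_gt h.1) _
  · intro s y z hs
    have h := mem_meanCone_iff (y := y) (z := z) ht hs
    rw [← hρ] at h
    by_cases hz : z ^ 2 < 3 * (ρ ^ 2 - y ^ 2)
    -- The cut-off `c = ρ` is vacuous inside the disc.
    · have hy : y ≤ ρ := by nlinarith [sq_nonneg z]
      rw [Set.indicator_of_mem (h.2 hz), jointDensity_eq, shapeDensity, if_pos ⟨hy, hz⟩]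
    · rw [Set.indicator_of_notMem (fun h' => hz (h.1 h')), shapeDensity,
        if_neg fun h' => hz h'.2, mul_zero]

lemma integral_meanCone_inter_nonpos {t : ℝ} (ht : 0 < t) (ht2 : 1 / 2 ≤ t ^ 2) (i : Fin 3) :
    ∫ x, (meanCone t ∩ {x | x i ≤ 0}).indicator jointDensity x =
      30 * √3 * (shapePrimitive (√2 / (3 * t)) (-(1 / 3)) -
        shapePrimitive (√2 / (3 * t)) (-(√2 / (3 * t)))) := by
  have hsymm : ∫ x, (meanCone t ∩ {x | x i ≤ 0}).indicator jointDensity x =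
      ∫ x, (meanCone t ∩ {x | x 0 ≤ 0}).indicator jointDensity x := by
    -- Cone, density and volume are invariant under swapping coordinates `0` and `i`.
    let e := MeasurableEquiv.piCongrLeft (fun _ : Fin 3 => ℝ) (Equiv.swap 0 i)
    have he : MeasurePreserving e volume volume :=
      volume_measurePreserving_piCongrLeft (fun _ : Fin 3 => ℝ) (Equiv.swap 0 i)
    rw [← he.integral_comp e.measurableEmbedding]
    congr 1
    funext x
    have hx : ∀ j, e x (Equiv.swap 0 i j) = x j := fun j =>
      MeasurableEquiv.piCongrLeft_apply_apply (β := fun _ : Fin 3 => ℝ) (Equiv.swap 0 i) x j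
    have h0 := hx 0
    have h1 := hx 1
    have h2 := hx 2
    simp only [Set.indicator_apply, Set.mem_inter_iff, meanCone, Set.mem_ofPred_eq, jointDensity]
    fin_cases i <;> simp [Equiv.swap_apply_def] at h0 h1 h2 ⊢ <;> rw [h0, h1, h2] <;>
      ring_nf
  rw [hsymm]
  set ρ := √2 / (3 * t) with hρ
  have hρ0 : 0 < ρ := by positivity
  have hρ1 : -(1 / 3) ≤ ρ := by linarith
  rw [integral_sum_pow_three_mul_exp (shapeDensity ρ (-(1 / 3)))
    (integrable_indicator_meanCone_inter ht2 (measurableSet_apply_nonpos 0)),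
    integral_shapeDensity hρ0 hρ1]
  · ring
  · intro x hx
    exact Set.indicator_of_notMem (fun h => hx.not_gt h.1.1) _
  · intro s y z hs
    have h := mem_meanCone_iff (y := y) (z := z) ht hs
    rw [← hρ] at h
    have hy : s * (y + 1 / 3) ≤ 0 ↔ y ≤ -(1 / 3) := by
      rw [← not_lt, mul_pos_iff_of_pos_left hs, not_lt]
      constructor <;> intro <;> linarith
    by_cases hz : y ≤ -(1 / 3) ∧ z ^ 2 < 3 * (ρ ^ 2 - y ^ 2)
    · rw [Set.indicator_of_mem (Set.mem_inter (h.2 hz.2) (hy.2 hz.1)), jointDensity_eq,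
        shapeDensity, if_pos hz]
    · rw [Set.indicator_of_notMem (fun h' => hz ⟨hy.1 h'.2, h.1 h'.1⟩), shapeDensity, if_neg hz,
        mul_zero]

/-! ### The distribution of the statistic -/

lemma gammaTwoLaw_pi : Measure.pi (fun _ : Fin 3 => gammaTwoLaw) =
    volume.withDensity fun x : Fin 3 → ℝ =>
      ENNReal.ofReal (∏ i, if 0 < x i then x i * Real.exp (-x i) else 0) :=
  pi_withDensity_ofReal (f := fun _ x => if 0 < x then x * Real.exp (-x) else 0)
    (fun _ => integrable_gammaTwo_density) fun _ x => by
      split_ifs with h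
      · positivity
      · exact le_rfl

lemma measurable_statT : Measurable (statT (n := 3)) := by
  unfold statT sampleVariance sampleMean
  fun_prop

lemma ae_apply_zero_ne_apply_one : ∀ᵐ x : Fin 3 → ℝ, x 0 ≠ x 1 := by
  let f : (Fin 3 → ℝ) →ₗ[ℝ] ℝ :=
    LinearMap.proj (R := ℝ) (φ := fun _ : Fin 3 => ℝ) 0 - LinearMap.proj 1
  have h : LinearMap.ker f ≠ ⊤ := by
    intro h
    have : (Pi.single 0 1 : Fin 3 → ℝ) ∈ LinearMap.ker f := h ▸ Submodule.mem_top
    simp [f] at this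
  refine measure_mono_null (fun x hx => ?_) (Measure.addHaar_submodule volume _ h)
  have : x 0 = x 1 := by simpa using hx
  simp [f, this]

lemma measureReal_lt_statT {t : ℝ} (ht : 0 < t) (ht2 : 1 / 2 ≤ t ^ 2) :
    (Measure.pi fun _ : Fin 3 => gammaTwoLaw).real {x | t < statT x} =
      30 * √3 * (shapePrimitive (√2 / (3 * t)) (√2 / (3 * t)) -
        shapePrimitive (√2 / (3 * t)) (-(√2 / (3 * t))) -
        3 * (shapePrimitive (√2 / (3 * t)) (-(1 / 3)) -
        shapePrimitive (√2 / (3 * t)) (-(√2 / (3 * t))))) := by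
  have hset : MeasurableSet {x : Fin 3 → ℝ | t < statT x} :=
    measurableSet_lt measurable_const measurable_statT
  have hw : Integrable fun x : Fin 3 → ℝ => ∏ i, if 0 < x i then x i * Real.exp (-x i) else 0 :=
    Integrable.fintype_prod (f := fun (_ : Fin 3) x => if 0 < x then x * Real.exp (-x) else 0)
      fun _ => integrable_gammaTwo_density
  have hw0 : ∀ x : Fin 3 → ℝ, 0 ≤ ∏ i, if 0 < x i then x i * Real.exp (-x i) else 0 := by
    intro x
    refine Finset.prod_nonneg fun i _ => ?_
    split_ifs with h
    · positivity
    · exact le_rfl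
  have h1 : (Measure.pi fun _ : Fin 3 => gammaTwoLaw).real {x | t < statT x} =
      ∫ x, {x : Fin 3 → ℝ | t < statT x}.indicator
        (fun x => ∏ i, if 0 < x i then x i * Real.exp (-x i) else 0) x := by
    rw [measureReal_def, gammaTwoLaw_pi, withDensity_apply _ hset,
      ← ofReal_integral_eq_lintegral_ofReal hw.integrableOn (ae_of_all _ hw0),
      ENNReal.toReal_ofReal (integral_nonneg hw0), integral_indicator hset]
  -- On the open octant no cap term is present. Elsewhere the true density is `0`, and inside the
  -- cone exactly one coordinate is nonpositive, so its cap term cancels the cone term.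
  have hae : ∀ᵐ x : Fin 3 → ℝ, {x : Fin 3 → ℝ | t < statT x}.indicator
      (fun x => ∏ i, if 0 < x i then x i * Real.exp (-x i) else 0) x =
      (meanCone t).indicator jointDensity x -
        ∑ i, (meanCone t ∩ {x | x i ≤ 0}).indicator jointDensity x := by
    filter_upwards [ae_apply_zero_ne_apply_one] with x hx
    by_cases hpos : ∀ i, 0 < x i
    · have hs : 0 < x 0 + x 1 + x 2 := by linarith [hpos 0, hpos 1, hpos 2]
      have hn : ∀ i, (meanCone t ∩ {x | x i ≤ 0}).indicator jointDensity x = 0 := fun i =>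
        Set.indicator_of_notMem (fun h => (hpos i).not_ge h.2) _
      have hd : (∏ i, if 0 < x i then x i * Real.exp (-x i) else 0) = jointDensity x := by
        simp only [hpos, if_true, Fin.prod_univ_three, jointDensity]
        rw [neg_add, neg_add, Real.exp_add, Real.exp_add]
        ring
      simp only [hn, Finset.sum_const_zero, sub_zero]
      classical
      simp only [Set.indicator_apply, Set.mem_ofPred_eq, lt_statT_iff ht hs hx, hd]
    · obtain ⟨i, hi⟩ := not_forall.1 hpos
      rw [not_lt] at hi
      have hz : (∏ i, if 0 < x i then x i * Real.exp (-x i) else 0) = 0 :=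
        Finset.prod_eq_zero (Finset.mem_univ i) (if_neg hi.not_gt)
      rw [Finset.sum_eq_single i]
      · by_cases hc : x ∈ meanCone t <;> simp [Set.indicator, hz, hi, hc]
      · intro j _ hj
        exact Set.indicator_of_notMem
          (fun h => (pos_of_mem_meanCone ht2 h.1 hj.symm hi).not_ge h.2) _
      · simp
  rw [h1, integral_congr_ae hae, integral_sub (integrable_indicator_meanCone ht2)
    (integrable_finsetSum _ fun i _ =>
      integrable_indicator_meanCone_inter ht2 (measurableSet_apply_nonpos i)),
    integral_finsetSum _ fun i _ =>
      integrable_indicator_meanCone_inter ht2 (measurableSet_apply_nonpos i),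
    integral_meanCone ht ht2]
  simp_rw [integral_meanCone_inter_nonpos ht ht2]
  simp
  ring

lemma cdf_statT_eq {Ω : Type*} [MeasurableSpace Ω] (P : Measure Ω) [IsProbabilityMeasure P]
    (X : Fin 3 → Ω → ℝ) (hindep : iIndepFun X P) (hlaw : ∀ i, HasLaw (X i) gammaTwoLaw P)
    {t : ℝ} (ht : 0 < t) (ht2 : 1 / 2 ≤ t ^ 2) :
    cdf (P.map fun ω => statT fun i => X i ω) t =
      1 - 30 * √3 * (shapePrimitive (√2 / (3 * t)) (√2 / (3 * t)) -
        shapePrimitive (√2 / (3 * t)) (-(√2 / (3 * t))) -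
        3 * (shapePrimitive (√2 / (3 * t)) (-(1 / 3)) -
        shapePrimitive (√2 / (3 * t)) (-(√2 / (3 * t))))) := by
  have hX := hindep.hasLaw_pi hlaw
  have hprob : IsProbabilityMeasure (Measure.pi fun _ : Fin 3 => gammaTwoLaw) := by
    rw [← hX.map_eq]
    exact Measure.isProbabilityMeasure_map hX.aemeasurable
  have hmap : (P.map fun ω => statT fun i => X i ω) =
      (Measure.pi fun _ : Fin 3 => gammaTwoLaw).map statT := by
    rw [← hX.map_eq, AEMeasurable.map_map_of_aemeasurable measurable_statT.aemeasurable
      hX.aemeasurable]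
    rfl
  have hprob' : IsProbabilityMeasure
      ((Measure.pi fun _ : Fin 3 => gammaTwoLaw).map (statT (n := 3))) :=
    Measure.isProbabilityMeasure_map measurable_statT.aemeasurable
  rw [hmap, cdf_eq_real, ← measureReal_lt_statT ht ht2, ← compl_compl (Set.Iic t),
    probReal_compl_eq_one_sub measurableSet_Iic.compl, Set.compl_Iic,
    map_measureReal_apply measurable_statT measurableSet_Ioi]
  rfl

/-! ### Closed forms -/

theorem proposition2 {Ω : Type*} [MeasurableSpace Ω] (P : Measure Ω) [IsProbabilityMeasure P]
    (X : Fin 3 → Ω → ℝ) (hindep : iIndepFun X P) (hlaw : ∀ i, HasLaw (X i) gammaTwoLaw P) :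
    (∀ t : ℝ, √2 ≤ t →
      cdf (P.map fun ω => statT fun i => X i ω) t =
        1 - 10 * Real.pi * (4 * t ^ 2 - 3) / (27 * √3 * t ^ 4)) ∧
    (∀ t : ℝ, √2 / 2 ≤ t → t ≤ √2 →
      cdf (P.map fun ω => statT fun i => X i ω) t =
        (√(2 - t ^ 2) * (-33 * t ^ 4 - 13 * t ^ 2 + 8) + 5 * Real.pi * t * (4 * t ^ 2 - 3)
            - 30 * t * (4 * t ^ 2 - 3) * Real.arcsin (t / √2)) / (27 * √3 * t ^ 5) + 1) ∧
    (∀ t : ℝ, t ≤ √2 / 2 → cdf (P.map fun ω => statT fun i => X i ω) t = 0) := by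
  have h2 : √2 ^ 2 = 2 := Real.sq_sqrt (by norm_num)
  have h3 : √3 ^ 2 = 3 := Real.sq_sqrt (by norm_num)
  have h30 : 30 * √3 = 90 / √3 := by
    field_simp
    rw [h3]
    norm_num
  have h20 : 0 < √2 := by positivity
  have hρ : ∀ t : ℝ, (√2 / (3 * t)) ^ 2 = 2 / (9 * t ^ 2) := by
    intro t
    rw [div_pow, h2]
    ring
  have hmid : ∀ t : ℝ, √2 / 2 ≤ t → t ≤ √2 →
      cdf (P.map fun ω => statT fun i => X i ω) t =
        (√(2 - t ^ 2) * (-33 * t ^ 4 - 13 * t ^ 2 + 8) + 5 * Real.pi * t * (4 * t ^ 2 - 3)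
            - 30 * t * (4 * t ^ 2 - 3) * Real.arcsin (t / √2)) / (27 * √3 * t ^ 5) + 1 := by
    intro t h1 h1'
    have ht : 0 < t := by linarith
    have ht2 : 1 / 2 ≤ t ^ 2 := by nlinarith
    rw [cdf_statT_eq P X hindep hlaw ht ht2, shapePrimitive_self (by positivity),
      shapePrimitive_neg_self (by positivity), shapePrimitive]
    have ha : -(1 / 3) / (√2 / (3 * t)) = -(t / √2) := by field_simp
    have hw : √((√2 / (3 * t)) ^ 2 - (-(1 / 3)) ^ 2) = √(2 - t ^ 2) / (3 * t) := by
      rw [hρ, ← Real.sqrt_sq (show 0 ≤ 3 * t by positivity), ← Real.sqrt_div' _ (sq_nonneg _)]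
      congr 1
      field_simp
      ring
    rw [hw, ha, Real.arcsin_neg, hρ, h30]
    field_simp
    ring
  refine ⟨fun t h1 => ?_, hmid, fun t h1 => ?_⟩
  -- Here `ρ ≤ 1/3`, so the caps contribute nothing.
  · have ht : 0 < t := by linarith
    have ht2 : 1 / 2 ≤ t ^ 2 := by nlinarith
    rw [cdf_statT_eq P X hindep hlaw ht ht2,
      shapePrimitive_of_le_neg (c := -(1 / 3)) (by positivity), shapePrimitive_self (by positivity),
      shapePrimitive_neg_self (by positivity), hρ, h30]
    · field_simp
      ring
    · rw [neg_le_neg_iff, div_le_iff₀ (by positivity)]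
      linarith
  -- The middle formula evaluates to `0` at `√2/2`; monotonicity and nonnegativity of the cdf give
  -- every smaller `t`.
  · have h0 := hmid (√2 / 2) le_rfl (by linarith)
    have harc : Real.arcsin (√2 / 2 / √2) = Real.pi / 6 := by
      rw [show √2 / 2 / √2 = Real.sin (Real.pi / 6) by
        rw [Real.sin_pi_div_six]; field_simp]
      exact Real.arcsin_sin (by linarith [Real.pi_pos]) (by linarith [Real.pi_pos])
    have hsq : √(2 - (√2 / 2) ^ 2) = √3 / √2 := by
      rw [← Real.sqrt_div (by norm_num), div_pow, h2]
      norm_num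
    have hz : cdf (P.map fun ω => statT fun i => X i ω) (√2 / 2) = 0 := by
      rw [h0, harc, hsq]
      have h4 : √2 ^ 4 = 4 := by
        rw [show √2 ^ 4 = (√2 ^ 2) ^ 2 by ring, h2]
        norm_num
      have h6 : √2 ^ 6 = 8 := by
        rw [show √2 ^ 6 = (√2 ^ 2) ^ 3 by ring, h2]
        norm_num
      field_simp
      ring_nf
      rw [h2, h4, h6]
      ring
    exact le_antisymm (hz ▸ monotone_cdf _ h1) (cdf_nonneg _ _)
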